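/- Let $0<p<1$. Let $\mathsf{BP}(t)$, $t\ge 0$, be the two-type (red/blue) continuous-time branching process started at time $0$ from a single red vertex, in which individuals live forever, each vertex $v$ gives birth at time $t$ at rate $c_B(v,t)+1$, where $c_B(v,t)$ is the number of blue children of $v$ at time $t$, and each newborn is independently coloured red with probability $p$ and blue with probability $1-p$. Equivalently, $\mathsf{BP}$ is the pure jump Markov process on finite rooted coloured trees in which a child of colour $c$ is added to the vertex $v$ at rate $(c_B(v,t)+1)\,p$ if $c$ is red and $(c_B(v,t)+1)(1-p)$ if $c$ is blue. Write $|\mathsf{BP}(t)|$ and $B(t)$ for the total number of vertices and of blue vertices at time $t$, and, for $k\ge 1$, $Z_{\ge k}(t)$ for the number of vertices of $\mathsf{BP}(t)$ that have at least $k$ blue children. Then there is a random variable $W^*$ such that, as $t\to\infty$, $e^{-(2-p)t}\bigl(|\mathsf{BP}(t)|+B(t)\bigr)\to W^*$ almost surely, and for every $k\ge 1$ $$e^{-(2-p)t}Z_{\ge k}(t)\;\longrightarrow\; p_{\ge k}(\infty)\,\frac{W^*}{2-p}\qquad\text{almost surely},$$ where $$p_{\ge k}(\infty)=k!\prod_{i=1}^{k}\Bigl(i+\frac{2-p}{1-p}\Bigr)^{-1}.$$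 -/

import Mathlib

open MeasureTheory Filter Topology
open scoped NNReal ENNReal

namespace TwoTypeBranching

/-- The two types of individuals. -/
inductive Colour where
  | red
  | blue
  deriving DecidableEq

/-- A genealogical tree with red and blue vertices, the vertices being numbered `0, 1, 2, …` in
order of birth. Vertex `0` is the root, which is red. Every other vertex is recorded as a pair
(its mother, its colour), the most recently born vertex at the head of the list.
So `[]` is the single red root, and `(v, c) :: T` is `T` with a new child of `v`, of colour `c`. -/
abbrev ColouredTree : Type := List (ℕ × Colour)

namespace ColouredTree

/-- The number of vertices, `|T|`. -/
def size (T : ColouredTree) : ℕ := T.length + 1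

/-- The vertices of `T`: `0, …, |T| - 1`. -/
def vertices (T : ColouredTree) : Finset ℕ := Finset.range (size T)

/-- The number of blue vertices of `T` (the root is red). -/
def numBlue (T : ColouredTree) : ℕ := T.countP (fun x => x.2 = Colour.blue)

/-- The number of blue children `c_B(v)` of the vertex `v` in `T`. -/
def blueChildren (T : ColouredTree) (v : ℕ) : ℕ := T.count (v, Colour.blue)

/-- The number of vertices of `T` with at least `k` blue children. -/
def numAtLeast (T : ColouredTree) (k : ℕ) : ℕ :=
  ((vertices T).filter (fun v => k ≤ blueChildren T v)).card

/-- The rate `λ(v) = c_B(v) + 1` at which the vertex `v` gives birth while the tree is `T`. -/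
noncomputable def birthRate (T : ColouredTree) (v : ℕ) : ℝ := (blueChildren T v : ℝ) + 1

/-- The total rate at which the state `T` is left. -/
noncomputable def totalRate (T : ColouredTree) : ℝ := ∑ v ∈ vertices T, birthRate T v

end ColouredTree

/-- The distribution of the colour of a newborn: red with probability `p`, blue with
probability `1 - p`. -/
noncomputable def colourProb (p : ℝ) : Colour → ℝ
  | Colour.red => p
  | Colour.blue => 1 - p

/-- The rate of the transition `T → (v, c) :: T`: the vertex `v` gives birth at rate `c_B(v) + 1`,
and the child independently gets the colour `c` with probability `colourProb p c`. -/
noncomputable def transitionRate (p : ℝ) (T : ColouredTree) (v : ℕ) (c : Colour) : ℝ :=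
  ColouredTree.birthRate T v * colourProb p c

/-- `BP` is (a realisation of) the two-type continuous-time branching process with parameter `p`:
the continuous-time pure jump Markov process on coloured trees, started at time `0` from the
single red root, which jumps from `T` to `(v, c) :: T` at rate `transitionRate p T v c`, for every
vertex `v` of `T` and every colour `c`.

Here `Y n` is the tree after the `n`-th jump and `H n` the holding time in the state `Y n`. The
condition `jump` says that, given `Y n = T` and the holding times `H 0, …, H (n - 1)`, the holding
time `H n` is exponential with parameter the total rate `q(T)`, and independently of it the next
state is `(v, c) :: T` with probability `transitionRate p T v c / q(T)`. (The tree `Y n` contains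
all of `Y 0, …, Y (n - 1)`, so this is conditioning on the whole history.) The condition `path`
says that `BP t = Y n` for `t` between the `n`-th and the `(n + 1)`-st jump. That there are only
finitely many jumps in a bounded time interval is not assumed. -/
structure IsTwoTypeBPWith {Ω : Type*} [MeasurableSpace Ω] (μ : Measure Ω) (p : ℝ)
    (BP : ℝ≥0 → Ω → ColouredTree) (Y : ℕ → Ω → ColouredTree) (H : ℕ → Ω → ℝ) : Prop where
  measurable_state : ∀ (n : ℕ) (T : ColouredTree), MeasurableSet {ω | Y n ω = T}
  measurable_holding : ∀ n : ℕ, Measurable (H n)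
  start : ∀ᵐ ω ∂μ, Y 0 ω = []
  jump : ∀ (n : ℕ) (T : ColouredTree) (A : Set (Fin n → ℝ)), MeasurableSet A →
    ∀ v ∈ ColouredTree.vertices T, ∀ (c : Colour) (s : ℝ), 0 ≤ s →
      μ {ω | Y n ω = T ∧ (fun i : Fin n => H i ω) ∈ A ∧ s < H n ω ∧ Y (n + 1) ω = (v, c) :: T}
        = μ {ω | Y n ω = T ∧ (fun i : Fin n => H i ω) ∈ A}
          * ENNReal.ofReal (Real.exp (-(ColouredTree.totalRate T * s))
              * (transitionRate p T v c / ColouredTree.totalRate T))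
  path : ∀ᵐ ω ∂μ, ∀ (n : ℕ) (t : ℝ≥0),
    ∑ i ∈ Finset.range n, H i ω ≤ (t : ℝ) → (t : ℝ) < ∑ i ∈ Finset.range (n + 1), H i ω →
      BP t ω = Y n ω

/-- `BP` is a realisation of the two-type branching process with parameter `p`, for some embedded
jump chain and holding times. -/
def IsTwoTypeBP {Ω : Type*} [MeasurableSpace Ω] (μ : Measure Ω) (p : ℝ)
    (BP : ℝ≥0 → Ω → ColouredTree) : Prop :=
  ∃ (Y : ℕ → Ω → ColouredTree) (H : ℕ → Ω → ℝ), IsTwoTypeBPWith μ p BP Y H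

/-- The process `M(t) = e^{-(2-p)t} (|BP(t)| + B(t))`. -/
noncomputable def martingaleM {Ω : Type*} (p : ℝ) (BP : ℝ≥0 → Ω → ColouredTree)
    (t : ℝ≥0) (ω : Ω) : ℝ :=
  Real.exp (-(2 - p) * (t : ℝ)) *
    ((ColouredTree.size (BP t ω) : ℝ) + (ColouredTree.numBlue (BP t ω) : ℝ))

/-- `p_{≥k}(∞) = k! ∏_{i=1}^k (i + (2-p)/(1-p))⁻¹`. -/
noncomputable def pAtLeast (p : ℝ) (k : ℕ) : ℝ :=
  (k.factorial : ℝ) * ∏ i ∈ Finset.Icc 1 k, ((i : ℝ) + (2 - p) / (1 - p))⁻¹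

end TwoTypeBranching

namespace TwoTypeBranching

/-! Write λ = 2 - p, let τ_n be the time of the n-th jump, and call |T| + B(T) the mass of T. Every
blue vertex raises the birth rate of its mother by one, so the total birth rate of a tree is exactly
its mass (`Valid.totalRate_eq`), and a birth raises the mass by λ on average. If the mass is q, the
next holding time H has E e^{-λH} = q/(q+λ), while the expected next mass is q+λ. Hence e^{-λτ_n}
mass(Y_n) is a nonnegative martingale of mean 1, and it converges almost surely to a finite W.

The proportions are settled on the jump chain, without reference to time. A tree function with
bounded increments, minus the sum of its conditional drifts, is o(n) almost surely
(`ae_tendsto_sub_sum_drift_div`). So mass(Y_n)/n → λ. The drift of Z_{≥k+1} is (k+1)(1-p)(Z_{≥k} -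
Z_{≥k+1})/mass, which ties y = Z_{≥k+1}/mass to its own running average and to that of Z_{≥k}/mass.
The Tauberian lemma `tendsto_of_tendsto_add_cesaro` turns this into convergence of y, and induction
on k yields the product formula.

Since the mass tends to infinity while the martingale has a finite limit, τ_n → ∞: there is no
explosion. Successive masses have ratio tending to 1, so a sandwich between jumps carries the limit
to continuous time (`tendsto_exp_mul_of_tendsto_jump`). Multiplying it by the limiting proportion
gives the theorem. -/

instance : Fintype Colour := ⟨{Colour.red, Colour.blue}, fun c => by cases c <;> simp⟩

/-! ### Combinatorics of coloured trees -/

namespace ColouredTree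

/-- The possible new entries of a tree: a mother in the tree together with a colour. -/
def children (T : ColouredTree) : Finset (ℕ × Colour) := vertices T ×ˢ Finset.univ

lemma mem_children {T : ColouredTree} {x : ℕ × Colour} : x ∈ children T ↔ x.1 < size T := by
  simp [children, vertices]

/-- The trees in which every mother is born before her children. -/
def Valid : ColouredTree → Prop
  | [] => True
  | x :: T => x ∈ children T ∧ Valid T

lemma size_cons (x : ℕ × Colour) (T : ColouredTree) : size (x :: T) = size T + 1 := rfl

/-- The number of vertices plus the number of blue vertices. -/
def mass (T : ColouredTree) : ℝ := (size T : ℝ) + (numBlue T : ℝ)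

lemma mass_nil : mass [] = 1 := by simp [mass, size, numBlue]

lemma mass_cons (x : ℕ × Colour) (T : ColouredTree) :
    mass (x :: T) = mass T + if x.2 = Colour.blue then 2 else 1 := by
  rcases x with ⟨v, _ | _⟩ <;> simp [mass, size, numBlue] <;> ring

lemma size_le_mass (T : ColouredTree) : (size T : ℝ) ≤ mass T := by simp [mass]

lemma size_pos (T : ColouredTree) : 0 < size T := Nat.succ_pos _

lemma mass_pos (T : ColouredTree) : 0 < mass T :=
  lt_of_lt_of_le (by exact_mod_cast size_pos T) (size_le_mass T)

lemma birthRate_pos (T : ColouredTree) (v : ℕ) : 0 < birthRate T v := by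
  unfold birthRate; positivity

lemma totalRate_pos (T : ColouredTree) : 0 < totalRate T :=
  Finset.sum_pos (fun v _ => birthRate_pos T v) ⟨0, by simp [vertices, size_pos]⟩

lemma blueChildren_cons (x : ℕ × Colour) (T : ColouredTree) (v : ℕ) :
    blueChildren (x :: T) v = blueChildren T v + if x = (v, Colour.blue) then 1 else 0 := by
  simp [blueChildren, List.count_cons]

lemma Valid.blueChildren_eq_zero {T : ColouredTree} (hT : Valid T) {v : ℕ} (hv : size T ≤ v) :
    blueChildren T v = 0 := by
  induction T with
  | nil => simp [blueChildren]
  | cons x T ih =>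
    rw [size_cons] at hv
    have hx := mem_children.1 hT.1
    rw [blueChildren_cons, ih hT.2 (by omega), if_neg]
    rintro rfl
    simp only at hx
    omega

lemma numBlue_cons (x : ℕ × Colour) (T : ColouredTree) :
    numBlue (x :: T) = numBlue T + if x.2 = Colour.blue then 1 else 0 := by
  simp [numBlue, List.countP_cons]

/-- Each blue vertex has exactly one mother; validity guarantees that she is among the vertices
summed over. -/
lemma Valid.sum_blueChildren {T : ColouredTree} (hT : Valid T) :
    ∑ v ∈ vertices T, blueChildren T v = numBlue T := by
  induction T with
  | nil => simp [blueChildren, vertices, size, numBlue]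
  | cons x T ih =>
    have hx := mem_children.1 hT.1
    have h1 : vertices (x :: T) = Finset.range (size T + 1) := rfl
    rw [h1, Finset.sum_congr rfl (fun v _ => blueChildren_cons x T v), Finset.sum_add_distrib,
      Finset.sum_range_succ, Valid.blueChildren_eq_zero hT.2 le_rfl, numBlue_cons, ← ih hT.2]
    rcases x with ⟨w, _ | _⟩
    · simp [vertices]
    · simp only [] at hx
      simp [vertices]
      omega

lemma Valid.totalRate_eq {T : ColouredTree} (hT : Valid T) : totalRate T = mass T := by
  simp only [totalRate, birthRate, mass, Finset.sum_add_distrib, ← hT.sum_blueChildren]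
  simp [vertices, add_comm]

/-- Only the mother can cross the threshold, by passing from k to k + 1 blue children. The newborn
has no children, so it never counts at a threshold k + 1 > 0. -/
lemma Valid.numAtLeast_cons {T : ColouredTree} (hT : Valid T) {x : ℕ × Colour}
    (hx : x ∈ children T) (k : ℕ) :
    numAtLeast (x :: T) (k + 1) = numAtLeast T (k + 1) +
      if x.2 = Colour.blue ∧ blueChildren T x.1 = k then 1 else 0 := by
  have hx' := mem_children.1 hx
  have h1 : vertices (x :: T) = Finset.range (size T + 1) := rfl
  have h2 : ∀ v ∈ Finset.range (size T), (if k + 1 ≤ blueChildren (x :: T) v then 1 else 0) =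
      (if k + 1 ≤ blueChildren T v then 1 else 0) +
        if v = x.1 then (if x.2 = Colour.blue ∧ blueChildren T x.1 = k then 1 else 0) else 0 := by
    intro v _
    rw [blueChildren_cons]
    rcases x with ⟨w, _ | _⟩
    · simp
    · by_cases hv : v = w
      · subst hv
        simp only [if_true, true_and]
        split_ifs <;> omega
      · simp [hv, Ne.symm hv]
  have h3 : blueChildren (x :: T) (size T) = 0 := by
    rw [blueChildren_cons, hT.blueChildren_eq_zero le_rfl, if_neg]
    rintro rfl
    simp at hx'
  simp only [numAtLeast, Finset.card_filter]
  rw [h1, Finset.sum_range_succ, h3, Finset.sum_congr rfl h2, Finset.sum_add_distrib,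
    Finset.sum_ite_eq', if_pos (Finset.mem_range.2 hx')]
  simp [vertices]

lemma numAtLeast_zero (T : ColouredTree) : numAtLeast T 0 = size T := by
  simp [numAtLeast, vertices]

lemma numAtLeast_le_size (T : ColouredTree) (k : ℕ) : numAtLeast T k ≤ size T := by
  simpa [numAtLeast, vertices] using
    Finset.card_filter_le (vertices T) (fun v => k ≤ blueChildren T v)

lemma sum_blueChildren_eq (T : ColouredTree) (k : ℕ) :
    ∑ v ∈ vertices T, (if blueChildren T v = k then (1 : ℝ) else 0) =
      numAtLeast T k - numAtLeast T (k + 1) := by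
  have h (j : ℕ) : (numAtLeast T j : ℝ) =
      ∑ v ∈ vertices T, (if j ≤ blueChildren T v then (1 : ℝ) else 0) := by
    simp [numAtLeast]
  rw [h, h, ← Finset.sum_sub_distrib]
  refine Finset.sum_congr rfl fun v _ => ?_
  split_ifs <;> first | omega | norm_num

end ColouredTree

/-! ### Jump probabilities and one-step drifts -/

open ColouredTree ProbabilityTheory

/-- The probability that `T` jumps to `x :: T`. -/
noncomputable def weight (p : ℝ) (T : ColouredTree) (x : ℕ × Colour) : ℝ :=
  transitionRate p T x.1 x.2 / totalRate T

lemma weight_nonneg {p : ℝ} (hp0 : 0 < p) (hp1 : p < 1) (T : ColouredTree) (x : ℕ × Colour) :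
    0 ≤ weight p T x := by
  refine div_nonneg (mul_nonneg (birthRate_pos T _).le ?_) (totalRate_pos T).le
  rcases x with ⟨v, _ | _⟩ <;> simp [colourProb] <;> linarith

lemma sum_weight_mul (p : ℝ) (T : ColouredTree) (g : ℕ × Colour → ℝ) :
    ∑ x ∈ children T, weight p T x * g x = (∑ v ∈ vertices T,
      birthRate T v * (p * g (v, Colour.red) + (1 - p) * g (v, Colour.blue))) / totalRate T := by
  have hu : (Finset.univ : Finset Colour) = {Colour.red, Colour.blue} := rfl
  rw [children, Finset.sum_product, Finset.sum_div]
  refine Finset.sum_congr rfl fun v _ => ?_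
  rw [hu, Finset.sum_pair (by decide)]
  simp only [weight, transitionRate, colourProb]
  ring

lemma sum_weight (p : ℝ) (T : ColouredTree) : ∑ x ∈ children T, weight p T x = 1 := by
  have h := sum_weight_mul p T (fun _ => 1)
  simp only [mul_one, add_sub_cancel] at h
  rw [h]
  exact div_self (totalRate_pos T).ne'

/-- Whoever the mother is, a red child adds 1 and a blue child adds 2: p + 2(1 - p) = 2 - p. -/
lemma sum_weight_mul_mass_sub (p : ℝ) (T : ColouredTree) :
    ∑ x ∈ children T, weight p T x * (mass (x :: T) - mass T) = 2 - p := by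
  rw [sum_weight_mul]
  simp only [mass_cons, add_sub_cancel_left, if_true, reduceCtorEq, if_false]
  rw [← Finset.sum_mul, ← totalRate, mul_comm, mul_div_assoc, div_self (totalRate_pos T).ne']
  ring

/-- The Z_{≥k} - Z_{≥k+1} vertices with exactly k blue children each have birth rate k + 1, and only
a blue birth promotes them. -/
lemma sum_weight_mul_numAtLeast_sub (p : ℝ) {T : ColouredTree} (hT : Valid T) (k : ℕ) :
    ∑ x ∈ children T,
      weight p T x * ((numAtLeast (x :: T) (k + 1) : ℝ) - numAtLeast T (k + 1)) =
      (k + 1) * (1 - p) * ((numAtLeast T k : ℝ) - numAtLeast T (k + 1)) / totalRate T := by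
  rw [← sum_blueChildren_eq, Finset.mul_sum]
  calc _ = ∑ x ∈ children T, weight p T x *
        (if x.2 = Colour.blue ∧ blueChildren T x.1 = k then 1 else 0) := by
        refine Finset.sum_congr rfl fun x hx => ?_
        rw [hT.numAtLeast_cons hx]
        push_cast
        ring
    _ = _ := by
        rw [sum_weight_mul]
        congr 1
        refine Finset.sum_congr rfl fun v _ => ?_
        by_cases h : blueChildren T v = k
        · simp [h, birthRate]
        · simp [h]

/-! ### Analytic tools: a Tauberian lemma and exponential laws -/

/-- If `y n` plus a multiple `c ≥ 0` of the running average of `y` converges, so does `y`. -/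
lemma tendsto_of_tendsto_add_cesaro {y : ℕ → ℝ} {c a : ℝ} (hc : 0 ≤ c)
    (h : Tendsto (fun n : ℕ => y n + c * ((∑ i ∈ Finset.range n, y i) / n)) atTop (𝓝 a)) :
    Tendsto y atTop (𝓝 (a / (1 + c))) := by
  set u := a / (1 + c) with hu
  have hc1 : (1 + c) ≠ 0 := by positivity
  have hua : u + c * u = a := by rw [hu]; field_simp
  set w : ℕ → ℝ := fun n => ∑ i ∈ Finset.range n, (y i - u) with hw
  set e : ℕ → ℝ := fun n => y n - u + c * (w n / n) with he
  have hwn : ∀ n : ℕ, 0 < n → w n / n = (∑ i ∈ Finset.range n, y i) / n - u := by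
    intro n hn
    have : (n : ℝ) ≠ 0 := by positivity
    simp only [hw, Finset.sum_sub_distrib, Finset.sum_const, Finset.card_range, nsmul_eq_mul]
    field_simp
  have he0 : Tendsto e atTop (𝓝 0) := by
    have h' := h.sub_const a
    rw [sub_self] at h'
    refine h'.congr' ?_
    filter_upwards [eventually_gt_atTop 0] with n hn
    simp only [he, hwn n hn, ← hua]
    ring
  obtain ⟨N, hN⟩ := exists_nat_ge c
  -- The centred partial sums satisfy w (n+1) = (1 - c/n) w n + e n with e → 0. Once n ≥ c the
  -- factor lies in [0, 1], so |w| grows at most by |e|, and Cesàro averaging of |e| gives w n =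
  -- o(n).
  have hstep : ∀ n, max N 1 ≤ n → |w (n + 1)| ≤ |w n| + |e n| := by
    intro n hn
    have hn1 : (1 : ℝ) ≤ n := by exact_mod_cast (le_max_right _ _).trans hn
    have hnc : c ≤ n := hN.trans (by exact_mod_cast (le_max_left _ _).trans hn)
    have hn0 : (n : ℝ) ≠ 0 := by positivity
    have h1 : w (n + 1) = w n * (1 - c / n) + e n := by
      simp only [he, hw, Finset.sum_range_succ]
      ring
    have h2 : |1 - c / n| ≤ 1 := by
      have h3 : c / n ≤ 1 := (div_le_one (by positivity)).2 hnc
      have h4 : 0 ≤ c / n := by positivity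
      rw [abs_of_nonneg (by linarith)]
      linarith
    rw [h1]
    refine (abs_add_le _ _).trans (add_le_add_left ?_ _)
    rw [abs_mul]
    exact mul_le_of_le_one_right (abs_nonneg _) h2
  set m := max N 1 with hm
  have hbound : ∀ n, m ≤ n → |w n| ≤ |w m| + ∑ i ∈ Finset.range n, |e i| := by
    intro n hn
    induction n, hn using Nat.le_induction with
    | base => exact le_add_of_nonneg_right (Finset.sum_nonneg fun i _ => abs_nonneg _)
    | succ n hn ih =>
      rw [Finset.sum_range_succ]
      linarith [hstep n hn]
  have hce : Tendsto (fun n : ℕ => (n⁻¹ : ℝ) * ∑ i ∈ Finset.range n, |e i|) atTop (𝓝 0) := by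
    simpa using he0.abs.cesaro
  have hcw : Tendsto (fun n : ℕ => |w m| / (n : ℝ)) atTop (𝓝 0) :=
    tendsto_const_div_atTop_nhds_zero_nat _
  have hw0 : Tendsto (fun n : ℕ => w n / n) atTop (𝓝 0) := by
    refine squeeze_zero_norm' ?_ (by simpa using hcw.add hce)
    filter_upwards [eventually_ge_atTop m] with n hn
    rw [Real.norm_eq_abs, abs_div, Nat.abs_cast, inv_mul_eq_div, ← add_div]
    exact div_le_div_of_nonneg_right (hbound n hn) (Nat.cast_nonneg n)
  have := (he0.sub (hw0.const_mul c)).add_const u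
  simp only [mul_zero, sub_zero, zero_add] at this
  refine this.congr fun n => ?_
  simp only [he]
  ring

lemma expMeasure_Ioi {r : ℝ} (hr : 0 < r) (s : ℝ) :
    expMeasure r (Set.Ioi s) = ENNReal.ofReal (Real.exp (-(r * max s 0))) := by
  have := isProbabilityMeasure_expMeasure hr
  rw [← Set.compl_Iic, prob_compl_eq_one_sub measurableSet_Iic, ← ofReal_cdf,
    cdf_expMeasure_eq hr, ← ENNReal.ofReal_one, ← ENNReal.ofReal_sub]
  · congr 1
    split_ifs with h
    · rw [max_eq_left h]; ring
    · rw [max_eq_right (not_le.1 h).le]; simp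
  · split_ifs with h
    · have : Real.exp (-(r * s)) ≤ 1 := Real.exp_le_one_iff.2 (by nlinarith)
      linarith
    · exact le_rfl

lemma lintegral_exp_neg_mul_expMeasure {r a : ℝ} (hr : 0 < r) (ha : 0 < a) :
    ∫⁻ x, ENNReal.ofReal (Real.exp (-a * x)) ∂(expMeasure r) = ENNReal.ofReal (r / (r + a)) := by
  have hm : Measurable (exponentialPDF r) := (measurable_exponentialPDFReal r).ennreal_ofReal
  have hm' : Measurable (exponentialPDF (r + a)) :=
    (measurable_exponentialPDFReal (r + a)).ennreal_ofReal
  have h1 : expMeasure r = volume.withDensity (exponentialPDF r) := rfl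
  rw [h1, lintegral_withDensity_eq_lintegral_mul _ hm (by fun_prop)]
  -- Exponential tilting: e^{-ax} times the density of rate r is r/(r+a) times the density of rate r
  -- + a.
  have h2 : ∀ x, (exponentialPDF r * fun x => ENNReal.ofReal (Real.exp (-a * x))) x =
      ENNReal.ofReal (r / (r + a)) * exponentialPDF (r + a) x := by
    intro x
    rw [Pi.mul_apply, exponentialPDF_eq, exponentialPDF_eq]
    split_ifs with hx
    · rw [← ENNReal.ofReal_mul (by positivity), ← ENNReal.ofReal_mul (by positivity), mul_assoc,
        ← Real.exp_add]
      congr 1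
      field_simp
      ring_nf
    · simp
  rw [lintegral_congr h2, lintegral_const_mul _ hm', lintegral_exponentialPDF_eq_one (by linarith),
    mul_one]

/-- There are countably many trees, so with the discrete σ-algebra measurability of `Y n` reduces to
its level sets and every function of a tree is measurable. -/
instance : MeasurableSpace ColouredTree := ⊤

instance : DiscreteMeasurableSpace ColouredTree := ⟨fun _ => trivial⟩

variable {Ω : Type*} [MeasurableSpace Ω] {μ : Measure Ω} {p : ℝ}
  {BP : ℝ≥0 → Ω → ColouredTree} {Y : ℕ → Ω → ColouredTree} {H : ℕ → Ω → ℝ}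

/-! ### The law of a single jump -/

namespace IsTwoTypeBPWith

lemma measurable_Y (h : IsTwoTypeBPWith μ p BP Y H) (n : ℕ) : Measurable (Y n) :=
  measurable_to_countable' fun T => h.measurable_state n T

lemma measurable_past (h : IsTwoTypeBPWith μ p BP Y H) (n : ℕ) :
    Measurable (fun ω => fun i : Fin n => H i ω) :=
  measurable_pi_lambda _ fun i => h.measurable_holding i

lemma sum_ofReal_weight (hp0 : 0 < p) (hp1 : p < 1) (T : ColouredTree) :
    ∑ x ∈ children T, ENNReal.ofReal (weight p T x) = 1 := by
  rw [← ENNReal.ofReal_sum_of_nonneg fun x _ => weight_nonneg hp0 hp1 T x, sum_weight,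
    ENNReal.ofReal_one]

/-- Almost surely every holding time is positive and every jump adds a child to the tree. -/
lemma ae_jump [IsProbabilityMeasure μ] (h : IsTwoTypeBPWith μ p BP Y H)
    (hp0 : 0 < p) (hp1 : p < 1) :
    ∀ᵐ ω ∂μ, ∀ n, 0 < H n ω ∧ ∃ x ∈ children (Y n ω), Y (n + 1) ω = x :: Y n ω := by
  rw [ae_all_iff]
  intro n
  have key : ∀ᵐ ω ∂μ, ∀ T, Y n ω = T → 0 < H n ω ∧ ∃ x ∈ children T, Y (n + 1) ω = x :: T := by
    rw [ae_all_iff]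
    intro T
    set G : ℕ × Colour → Set Ω := fun x => {ω | Y n ω = T ∧ 0 < H n ω ∧ Y (n + 1) ω = x :: T}
    have hG : ∀ x, MeasurableSet (G x) := fun x =>
      (h.measurable_state n T).inter ((measurableSet_lt measurable_const (h.measurable_holding n)).inter
        (h.measurable_state (n + 1) (x :: T)))
    have hμG : ∀ x ∈ children T, μ (G x) = μ {ω | Y n ω = T} * ENNReal.ofReal (weight p T x) := by
      intro x hx
      have := h.jump n T Set.univ MeasurableSet.univ x.1 (by simpa [vertices] using mem_children.1 hx)
        x.2 0 le_rfl
      simpa [G, weight] using this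
    -- The case s = 0 of `jump` gives the legal jumps after positive holding times; their
    -- probabilities already exhaust {Y n = T}, so everything else is null.
    have hU : μ (⋃ x ∈ children T, G x) = μ {ω | Y n ω = T} := by
      rw [measure_biUnion_finset _ fun x _ => hG x, Finset.sum_congr rfl hμG, ← Finset.mul_sum,
        sum_ofReal_weight hp0 hp1, mul_one]
      intro x _ y _ hxy
      refine Set.disjoint_left.2 fun ω h1 h2 => hxy ?_
      have := h1.2.2.symm.trans h2.2.2
      simpa using this
    have hsub : (⋃ x ∈ children T, G x) ⊆ {ω | Y n ω = T} :=
      Set.iUnion₂_subset fun x _ ω hω => hω.1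
    have hd : μ ({ω | Y n ω = T} \ ⋃ x ∈ children T, G x) = 0 := by
      rw [measure_sdiff hsub (Finset.measurableSet_biUnion _ fun x _ => hG x).nullMeasurableSet
        (measure_ne_top _ _), hU, tsub_self]
    refine measure_mono_null (fun ω hω => ?_) hd
    simp only [Set.mem_compl_iff, Set.mem_ofPred_eq, Classical.not_imp] at hω
    refine ⟨hω.1, fun hmem => hω.2 ?_⟩
    obtain ⟨x, hx, hxω⟩ := Set.mem_iUnion₂.1 hmem
    exact ⟨hxω.2.1, x, hx, hxω.2.2⟩
  filter_upwards [key] with ω hω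
  exact hω _ rfl

/-- Almost surely the trees are valid and `Y i` is recovered from `Y n` for `i ≤ n`. -/
lemma ae_history [IsProbabilityMeasure μ] (h : IsTwoTypeBPWith μ p BP Y H)
    (hp0 : 0 < p) (hp1 : p < 1) :
    ∀ᵐ ω ∂μ, ∀ n, Valid (Y n ω) ∧ size (Y n ω) = n + 1 ∧
      ∀ i ≤ n, Y i ω = (Y n ω).drop (n - i) := by
  filter_upwards [h.ae_jump hp0 hp1, h.start] with ω hω h0 n
  induction n with
  | zero => simp [h0, Valid, size]
  | succ n ih =>
    obtain ⟨-, x, hx, hY⟩ := hω n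
    rw [hY]
    refine ⟨⟨hx, ih.1⟩, by rw [size_cons, ih.2.1], fun i hi => ?_⟩
    rcases Nat.lt_or_eq_of_le hi with hi | rfl
    · rw [ih.2.2 i (by omega), show n + 1 - i = (n - i) + 1 by omega, List.drop_succ_cons]
    · simp [hY]

/-- Positivity of the holding time allows s < 0, so that the half-lines (s, ∞) form a generating
family for all of ℝ. -/
lemma measure_jump [IsProbabilityMeasure μ] (h : IsTwoTypeBPWith μ p BP Y H)
    (hp0 : 0 < p) (hp1 : p < 1) (n : ℕ) (T : ColouredTree) {A : Set (Fin n → ℝ)}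
    (hA : MeasurableSet A) {x : ℕ × Colour}
    (hx : x ∈ children T) (s : ℝ) :
    μ {ω | Y n ω = T ∧ (fun i : Fin n => H i ω) ∈ A ∧ s < H n ω ∧ Y (n + 1) ω = x :: T}
      = μ {ω | Y n ω = T ∧ (fun i : Fin n => H i ω) ∈ A} *
        (ENNReal.ofReal (weight p T x) * expMeasure (totalRate T) (Set.Ioi s)) := by
  have h1 := h.jump n T A hA x.1 (by simpa [vertices] using mem_children.1 hx) x.2 (max s 0)
    (le_max_right _ _)
  rw [expMeasure_Ioi (totalRate_pos T), mul_comm (ENNReal.ofReal _) (ENNReal.ofReal _),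
    ← ENNReal.ofReal_mul (Real.exp_pos _).le]
  refine Eq.trans (measure_congr ?_) h1
  filter_upwards [h.ae_jump hp0 hp1] with ω hω
  have hs : s < H n ω ↔ max s 0 < H n ω := by simp [(hω n).1]
  exact propext (and_congr_right' (and_congr_right' (and_congr_left' hs)))

/-- The joint law of the past holding times and the present one on a given transition. -/
lemma map_holding_eq_prod [IsProbabilityMeasure μ] (h : IsTwoTypeBPWith μ p BP Y H)
    (hp0 : 0 < p) (hp1 : p < 1) (n : ℕ) (T : ColouredTree) {x : ℕ × Colour} (hx : x ∈ children T) :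
    (μ.restrict {ω | Y n ω = T ∧ Y (n + 1) ω = x :: T}).map
        (fun ω => ((fun i : Fin n => H i ω), H n ω)) =
      ((μ.restrict {ω | Y n ω = T}).map (fun ω => fun i : Fin n => H i ω)).prod
        (ENNReal.ofReal (weight p T x) • expMeasure (totalRate T)) := by
  have := isProbabilityMeasure_expMeasure (totalRate_pos T)
  have : IsFiniteMeasure (ENNReal.ofReal (weight p T x) • expMeasure (totalRate T)) :=
    Measure.smul_finite _ ENNReal.ofReal_ne_top
  symm
  refine Measure.prod_eq_generateFrom (C := {s | MeasurableSet s}) (D := Set.range Set.Ioi)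
    MeasurableSpace.generateFrom_measurableSet ?_ MeasurableSpace.isPiSystem_measurableSet
    isPiSystem_Ioi
    (Measure.toFiniteSpanningSetsIn _)
    ⟨fun k => Set.Ioi (-(k : ℝ)), fun k => ⟨_, rfl⟩, fun k => measure_lt_top _ _, ?_⟩ ?_
  · rw [← borel_eq_generateFrom_Ioi, BorelSpace.measurable_eq (α := ℝ)]
  · refine Set.eq_univ_of_forall fun y => ?_
    obtain ⟨k, hk⟩ := exists_nat_gt (-y)
    exact Set.mem_iUnion.2 ⟨k, by simp only [Set.mem_Ioi]; linarith⟩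
  · rintro A (hA : MeasurableSet A) _ ⟨s, rfl⟩
    rw [Measure.map_apply ((h.measurable_past n).prodMk (h.measurable_holding n))
      (hA.prod measurableSet_Ioi), Measure.map_apply (h.measurable_past n) hA,
      Measure.restrict_apply ((h.measurable_past n) hA), Measure.restrict_apply
      (((h.measurable_past n).prodMk (h.measurable_holding n)) (hA.prod measurableSet_Ioi)),
      Measure.smul_apply, smul_eq_mul]
    convert h.measure_jump hp0 hp1 n T hA hx s using 2
    · ext ω
      simp only [Set.mem_inter_iff, Set.mem_preimage, Set.mem_prod, Set.mem_Ioi, Set.mem_ofPred_eq]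
      tauto
    · congr 1
      ext ω
      simp only [Set.mem_inter_iff, Set.mem_preimage, Set.mem_ofPred_eq]
      tauto

/-- One-step formula: integrating out the present holding time and the next jump. -/
lemma setLIntegral_step [IsProbabilityMeasure μ] (h : IsTwoTypeBPWith μ p BP Y H)
    (hp0 : 0 < p) (hp1 : p < 1) (n : ℕ) (T : ColouredTree) {f : (Fin n → ℝ) → ℝ≥0∞}
    (hf : Measurable f) {ψ : ℝ → ℝ≥0∞} (hψ : Measurable ψ) (G : ColouredTree → ℝ≥0∞) :
    ∫⁻ ω in {ω | Y n ω = T}, f (fun i => H i ω) * ψ (H n ω) * G (Y (n + 1) ω) ∂μ =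
      (∫⁻ ω in {ω | Y n ω = T}, f (fun i => H i ω) ∂μ) *
        ((∫⁻ s, ψ s ∂(expMeasure (totalRate T))) *
          ∑ x ∈ children T, ENNReal.ofReal (weight p T x) * G (x :: T)) := by
  have := isProbabilityMeasure_expMeasure (totalRate_pos T)
  set E : ℕ × Colour → Set Ω := fun x => {ω | Y n ω = T ∧ Y (n + 1) ω = x :: T} with hE
  have hEm : ∀ x, MeasurableSet (E x) := fun x =>
    (h.measurable_state n T).inter (h.measurable_state (n + 1) (x :: T))
  have hae : ({ω | Y n ω = T} : Set Ω) =ᵐ[μ] (⋃ x ∈ children T, E x : Set Ω) := by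
    filter_upwards [h.ae_jump hp0 hp1] with ω hω
    refine propext ⟨fun hT => ?_, fun hmem => ?_⟩
    · obtain ⟨-, x, hx, hY⟩ := hω n
      have hT' : Y n ω = T := hT
      rw [hT'] at hx hY
      exact Set.mem_iUnion₂.2 ⟨x, hx, hT', hY⟩
    · obtain ⟨x, hx, hxω⟩ := Set.mem_iUnion₂.1 hmem
      exact hxω.1
  rw [setLIntegral_congr hae, lintegral_biUnion_finset _ fun x _ => hEm x, Finset.mul_sum,
    Finset.mul_sum]
  · refine Finset.sum_congr rfl fun x hx => ?_
    rw [setLIntegral_congr_fun (hEm x)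
      (g := fun ω => (f (fun i => H i ω) * ψ (H n ω)) * G (x :: T))
      (fun ω hω => by simp only [hω.2]),
      lintegral_mul_const _ (show Measurable fun ω => f (fun i => H i ω) * ψ (H n ω) from
        (hf.comp (h.measurable_past n)).mul (hψ.comp (h.measurable_holding n)))]
    have hmap := lintegral_map (μ := μ.restrict (E x))
      (f := fun z : (Fin n → ℝ) × ℝ => f z.1 * ψ z.2)
      ((hf.comp measurable_fst).mul (hψ.comp measurable_snd))
      ((h.measurable_past n).prodMk (h.measurable_holding n))
    rw [h.map_holding_eq_prod hp0 hp1 n T hx, lintegral_prod_mul hf.aemeasurable hψ.aemeasurable,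
      lintegral_map hf (h.measurable_past n), lintegral_smul_measure] at hmap
    rw [← hmap, smul_eq_mul]
    ring
  · intro x _ y _ hxy
    refine Set.disjoint_left.2 fun ω h1 h2 => hxy ?_
    have := h1.2.symm.trans h2.2
    simpa using this

lemma lintegral_eq_tsum (h : IsTwoTypeBPWith μ p BP Y H) (n : ℕ) (F : Ω → ℝ≥0∞) :
    ∫⁻ ω, F ω ∂μ = ∑' T, ∫⁻ ω in {ω | Y n ω = T}, F ω ∂μ := by
  rw [← lintegral_iUnion (fun T => h.measurable_state n T)]
  · rw [← setLIntegral_univ]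
    congr
    exact (Set.eq_univ_of_forall fun ω => Set.mem_iUnion.2 ⟨Y n ω, rfl⟩).symm
  · intro S T hST
    exact Set.disjoint_left.2 fun ω h1 h2 => hST (h1.symm.trans h2)

/-- The Markov property of the embedded chain. -/
lemma lintegral_succ [IsProbabilityMeasure μ] (h : IsTwoTypeBPWith μ p BP Y H)
    (hp0 : 0 < p) (hp1 : p < 1) (n : ℕ) (G : ColouredTree → ℝ≥0∞) :
    ∫⁻ ω, G (Y (n + 1) ω) ∂μ = ∫⁻ ω, ∑ x ∈ children (Y n ω),
      ENNReal.ofReal (weight p (Y n ω) x) * G (x :: Y n ω) ∂μ := by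
  rw [h.lintegral_eq_tsum n, h.lintegral_eq_tsum n]
  refine tsum_congr fun T => ?_
  have := isProbabilityMeasure_expMeasure (totalRate_pos T)
  have h1 := h.setLIntegral_step hp0 hp1 n T (f := fun _ => 1) measurable_const (ψ := fun _ => 1)
    measurable_const G
  simp only [one_mul, lintegral_const, measure_univ] at h1
  rw [h1, setLIntegral_congr_fun (h.measurable_state n T)
    (g := fun _ => ∑ x ∈ children T, ENNReal.ofReal (weight p T x) * G (x :: T))
    (fun ω hω => by
      have hω' : Y n ω = T := hω
      simp only [hω']), lintegral_const, mul_comm]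

end IsTwoTypeBPWith
-- Compensated tree functions and the law of large numbers
/-- The expected increment of `φ` at the next jump from `T`. -/
noncomputable def drift (p : ℝ) (φ : ColouredTree → ℝ) (T : ColouredTree) : ℝ :=
  ∑ x ∈ children T, weight p T x * (φ (x :: T) - φ T)

/-- The martingale part of `φ` along the genealogy. -/
noncomputable def compensated (p : ℝ) (φ : ColouredTree → ℝ) : ColouredTree → ℝ
  | [] => 0
  | x :: T => compensated p φ T + (φ (x :: T) - φ T - drift p φ T)

lemma abs_drift_le {p : ℝ} (hp0 : 0 < p) (hp1 : p < 1) {φ : ColouredTree → ℝ} {T : ColouredTree}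
    {C : ℝ} (hC : ∀ x ∈ children T, |φ (x :: T) - φ T| ≤ C) : |drift p φ T| ≤ C := by
  calc |drift p φ T| ≤ ∑ x ∈ children T, |weight p T x * (φ (x :: T) - φ T)| :=
        Finset.abs_sum_le_sum_abs _ _
    _ ≤ ∑ x ∈ children T, weight p T x * C := by
        refine Finset.sum_le_sum fun x hx => ?_
        rw [abs_mul, abs_of_nonneg (weight_nonneg hp0 hp1 T x)]
        exact mul_le_mul_of_nonneg_left (hC x hx) (weight_nonneg hp0 hp1 T x)
    _ = C := by rw [← Finset.sum_mul, sum_weight, one_mul]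

lemma abs_compensated_cons_sub_le {p : ℝ} (hp0 : 0 < p) (hp1 : p < 1) {φ : ColouredTree → ℝ}
    {T : ColouredTree} {C : ℝ} (hC : ∀ x ∈ children T, |φ (x :: T) - φ T| ≤ C)
    {x : ℕ × Colour} (hx : x ∈ children T) :
    |compensated p φ (x :: T) - compensated p φ T| ≤ 2 * C := by
  rw [compensated, add_sub_cancel_left]
  calc _ ≤ |φ (x :: T) - φ T| + |drift p φ T| := abs_sub _ _
    _ ≤ _ := by linarith [hC x hx, abs_drift_le hp0 hp1 hC]

/-- The compensated increment has conditional mean zero, so the cross term vanishes and only its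
square, at most (2C)², is added. -/
lemma sum_weight_mul_compensated_sq_le {p : ℝ} (hp0 : 0 < p) (hp1 : p < 1) {φ : ColouredTree → ℝ}
    {T : ColouredTree} {C : ℝ} (hC : ∀ x ∈ children T, |φ (x :: T) - φ T| ≤ C) :
    ∑ x ∈ children T, weight p T x * compensated p φ (x :: T) ^ 2 ≤
      compensated p φ T ^ 2 + (2 * C) ^ 2 := by
  set c := compensated p φ T with hc
  set δ : ℕ × Colour → ℝ := fun x => φ (x :: T) - φ T - drift p φ T with hδ
  have h0 : ∑ x ∈ children T, weight p T x * δ x = 0 := by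
    simp only [hδ, mul_sub (weight p T _) (_ - _) (drift p φ T), Finset.sum_sub_distrib,
      ← Finset.sum_mul, sum_weight, one_mul]
    exact sub_self _
  have h1 : ∑ x ∈ children T, weight p T x * compensated p φ (x :: T) ^ 2 =
      c ^ 2 + ∑ x ∈ children T, weight p T x * δ x ^ 2 := by
    have : ∀ x, weight p T x * compensated p φ (x :: T) ^ 2 =
        weight p T x * c ^ 2 + 2 * c * (weight p T x * δ x) + weight p T x * δ x ^ 2 := by
      intro x
      rw [compensated]
      ring
    simp only [this, Finset.sum_add_distrib, ← Finset.sum_mul, ← Finset.mul_sum, h0, sum_weight]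
    ring
  rw [h1]
  gcongr
  calc ∑ x ∈ children T, weight p T x * δ x ^ 2 ≤ ∑ x ∈ children T, weight p T x * (2 * C) ^ 2 := by
        refine Finset.sum_le_sum fun x hx =>
          mul_le_mul_of_nonneg_left ?_ (weight_nonneg hp0 hp1 T x)
        have := abs_compensated_cons_sub_le hp0 hp1 hC hx
        rw [compensated, add_sub_cancel_left] at this
        exact sq_le_sq' (by linarith [neg_abs_le (δ x)]) ((le_abs_self _).trans this)
    _ = (2 * C) ^ 2 := by rw [← Finset.sum_mul, sum_weight, one_mul]

/-- A sequence with bounded increments is `o(n)` if it is so along the squares. -/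
lemma tendsto_div_of_tendsto_div_sq {a : ℕ → ℝ} {C : ℝ} (hC : ∀ n, |a (n + 1) - a n| ≤ C)
    (h : Tendsto (fun m : ℕ => a ((m + 1) ^ 2) / ((m : ℝ) + 1) ^ 2) atTop (𝓝 0)) :
    Tendsto (fun n : ℕ => a n / n) atTop (𝓝 0) := by
  have hC0 : 0 ≤ C := (abs_nonneg _).trans (hC 0)
  have hinc : ∀ m j, |a (m + j)| ≤ |a m| + C * j := by
    intro m j
    induction j with
    | zero => simp
    | succ j ih =>
      have h1 : |a (m + (j + 1))| ≤ |a (m + (j + 1)) - a (m + j)| + |a (m + j)| := by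
        simpa using abs_add_le (a (m + (j + 1)) - a (m + j)) (a (m + j))
      have h2 := hC (m + j)
      rw [add_assoc] at h2
      push_cast
      linarith
  have hsqrt : Tendsto (fun n : ℕ => Nat.sqrt n - 1) atTop atTop := by
    refine tendsto_atTop.2 fun b => ?_
    filter_upwards [eventually_ge_atTop ((b + 1) * (b + 1))] with n hn
    have := Nat.le_sqrt.2 hn
    omega
  have h2 : Tendsto (fun m : ℕ => 2 * C * (1 / ((m : ℝ) + 1))) atTop (𝓝 0) := by
    simpa using tendsto_one_div_add_atTop_nhds_zero_nat.const_mul (2 * C)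
  have h3 := (h.abs.add (by simpa using h2)).comp hsqrt
  simp only [abs_zero, add_zero] at h3
  refine squeeze_zero_norm' ?_ h3
  filter_upwards [eventually_ge_atTop 1] with n hn
  obtain ⟨m, hm⟩ : ∃ m, Nat.sqrt n = m + 1 :=
    ⟨Nat.sqrt n - 1, by have := Nat.le_sqrt.2 (show 1 * 1 ≤ n by omega); omega⟩
  have hle : (m + 1) ^ 2 ≤ n := by rw [← hm]; exact Nat.sqrt_le' n
  -- The gap to the preceding square is at most 2√n, so bounded increments contribute only O(√n) =
  -- o(n).
  have hge : n ≤ (m + 1) ^ 2 + 2 * (m + 1) := by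
    have := Nat.sqrt_le_add n
    rw [hm] at this
    nlinarith
  have hb : |a n| ≤ |a ((m + 1) ^ 2)| + 2 * C * (m + 1) := by
    have h4 := hinc ((m + 1) ^ 2) (n - (m + 1) ^ 2)
    rw [Nat.add_sub_cancel' hle] at h4
    have h5 : ((n - (m + 1) ^ 2 : ℕ) : ℝ) ≤ 2 * (m + 1) := by
      have : n - (m + 1) ^ 2 ≤ 2 * (m + 1) := by omega
      exact_mod_cast this
    nlinarith [mul_le_mul_of_nonneg_left h5 hC0]
  have hle' : ((m : ℝ) + 1) ^ 2 ≤ n := by exact_mod_cast hle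
  have hpos : (0 : ℝ) < ((m : ℝ) + 1) ^ 2 := by positivity
  simp only [Function.comp, hm, Nat.add_sub_cancel]
  rw [Real.norm_eq_abs, abs_div, Nat.abs_cast, abs_div, abs_of_pos hpos]
  calc |a n| / n ≤ |a n| / ((m : ℝ) + 1) ^ 2 :=
        div_le_div_of_nonneg_left (abs_nonneg _) hpos hle'
    _ ≤ (|a ((m + 1) ^ 2)| + 2 * C * (m + 1)) / ((m : ℝ) + 1) ^ 2 :=
        div_le_div_of_nonneg_right hb hpos.le
    _ = _ := by field_simp

namespace IsTwoTypeBPWith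

lemma lintegral_compensated_sq_le [IsProbabilityMeasure μ] (h : IsTwoTypeBPWith μ p BP Y H)
    (hp0 : 0 < p) (hp1 : p < 1) {φ : ColouredTree → ℝ} {C : ℝ}
    (hC : ∀ T, Valid T → ∀ x ∈ children T, |φ (x :: T) - φ T| ≤ C) (n : ℕ) :
    ∫⁻ ω, ENNReal.ofReal (compensated p φ (Y n ω) ^ 2) ∂μ ≤ ENNReal.ofReal (n * (2 * C) ^ 2) := by
  induction n with
  | zero =>
    refine le_of_eq ?_
    rw [lintegral_congr_ae (g := fun _ => 0)]
    · simp
    · filter_upwards [h.start] with ω hω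
      simp [hω, compensated]
  | succ n ih =>
    rw [h.lintegral_succ hp0 hp1 n fun T => ENNReal.ofReal (compensated p φ T ^ 2)]
    calc _ ≤ ∫⁻ ω, (ENNReal.ofReal (compensated p φ (Y n ω) ^ 2) +
          ENNReal.ofReal ((2 * C) ^ 2)) ∂μ := by
          refine lintegral_mono_ae ?_
          filter_upwards [h.ae_history hp0 hp1] with ω hω
          rw [← ENNReal.ofReal_add (sq_nonneg _) (sq_nonneg _)]
          refine le_trans (le_of_eq ?_) (ENNReal.ofReal_le_ofReal
            (sum_weight_mul_compensated_sq_le hp0 hp1 (hC _ (hω n).1)))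
          rw [ENNReal.ofReal_sum_of_nonneg fun x _ =>
            mul_nonneg (weight_nonneg hp0 hp1 _ x) (sq_nonneg _)]
          exact Finset.sum_congr rfl fun x _ =>
            (ENNReal.ofReal_mul (weight_nonneg hp0 hp1 _ x)).symm
      _ = (∫⁻ ω, ENNReal.ofReal (compensated p φ (Y n ω) ^ 2) ∂μ) +
          ENNReal.ofReal ((2 * C) ^ 2) := by
          rw [lintegral_add_right _ measurable_const]
          simp
      _ ≤ ENNReal.ofReal (n * (2 * C) ^ 2) + ENNReal.ofReal ((2 * C) ^ 2) := by gcongr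
      _ = _ := by
          rw [← ENNReal.ofReal_add (by positivity) (by positivity)]
          congr 1
          push_cast
          ring

/-- The second moment grows linearly, so along n = (m+1)² that of the quotient is O((m+1)⁻²), which
is summable; bounded increments fill the gaps between squares. -/
lemma ae_tendsto_compensated_div [IsProbabilityMeasure μ] (h : IsTwoTypeBPWith μ p BP Y H)
    (hp0 : 0 < p) (hp1 : p < 1) {φ : ColouredTree → ℝ} {C : ℝ}
    (hC : ∀ T, Valid T → ∀ x ∈ children T, |φ (x :: T) - φ T| ≤ C) :
    ∀ᵐ ω ∂μ, Tendsto (fun n : ℕ => compensated p φ (Y n ω) / n) atTop (𝓝 0) := by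
  have hmeas : ∀ n, Measurable fun ω => compensated p φ (Y n ω) := fun n =>
    (Measurable.of_discrete (f := compensated p φ)).comp (h.measurable_Y n)
  set F : ℕ → Ω → ℝ≥0∞ := fun m ω =>
    ENNReal.ofReal ((compensated p φ (Y ((m + 1) ^ 2) ω) / ((m : ℝ) + 1) ^ 2) ^ 2) with hF
  have hFm : ∀ m, Measurable (F m) := fun m => ((((hmeas _).div_const _).pow_const 2)).ennreal_ofReal
  have hFi : ∀ m, ∫⁻ ω, F m ω ∂μ ≤ ENNReal.ofReal ((2 * C) ^ 2 * (1 / ((m : ℝ) + 1) ^ 2)) := by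
    intro m
    have hpos : (0 : ℝ) < ((m : ℝ) + 1) ^ 2 := by positivity
    have h1 : ∀ ω, F m ω = ENNReal.ofReal (compensated p φ (Y ((m + 1) ^ 2) ω) ^ 2) *
        ENNReal.ofReal (1 / (((m : ℝ) + 1) ^ 2) ^ 2) := by
      intro ω
      rw [← ENNReal.ofReal_mul (sq_nonneg _)]
      simp only [hF, div_pow, mul_one_div]
    rw [lintegral_congr h1, lintegral_mul_const _ ((hmeas _).pow_const 2).ennreal_ofReal]
    calc _ ≤ ENNReal.ofReal (((m + 1) ^ 2 : ℕ) * (2 * C) ^ 2) *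
          ENNReal.ofReal (1 / (((m : ℝ) + 1) ^ 2) ^ 2) := by
          gcongr
          exact h.lintegral_compensated_sq_le hp0 hp1 hC _
      _ = _ := by
          rw [← ENNReal.ofReal_mul (by positivity)]
          congr 1
          push_cast
          field_simp
  have hsum : Summable fun m : ℕ => (2 * C) ^ 2 * (1 / ((m : ℝ) + 1) ^ 2) := by
    have := (summable_nat_add_iff 1).2 (Real.summable_one_div_nat_pow.2 (one_lt_two))
    exact (by simpa using this : Summable fun m : ℕ => 1 / ((m : ℝ) + 1) ^ 2).mul_left _
  have hfin : ∫⁻ ω, ∑' m, F m ω ∂μ ≠ ∞ := by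
    rw [lintegral_tsum fun m => (hFm m).aemeasurable]
    exact ne_top_of_le_ne_top hsum.tsum_ofReal_ne_top (ENNReal.tsum_le_tsum hFi)
  filter_upwards [ae_lt_top (Measurable.tsum hFm) hfin, h.ae_jump hp0 hp1,
    h.ae_history hp0 hp1] with ω hω hj hv
  refine tendsto_div_of_tendsto_div_sq (C := 2 * C) (fun n => ?_) ?_
  · obtain ⟨-, x, hx, hY⟩ := hj n
    rw [hY]
    exact abs_compensated_cons_sub_le hp0 hp1 (hC _ (hv n).1) hx
  · have h1 := ENNReal.tendsto_atTop_zero_of_tsum_ne_top hω.ne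
    have h2 := (ENNReal.tendsto_toReal ENNReal.zero_ne_top).comp h1
    have h3 : Tendsto (fun m : ℕ => (compensated p φ (Y ((m + 1) ^ 2) ω) / ((m : ℝ) + 1) ^ 2) ^ 2)
        atTop (𝓝 0) := by
      refine h2.congr fun m => ?_
      simp only [Function.comp, hF]
      exact ENNReal.toReal_ofReal (sq_nonneg _)
    have h4 := h3.sqrt
    simp only [Real.sqrt_sq_eq_abs, Real.sqrt_zero] at h4
    exact (tendsto_zero_iff_abs_tendsto_zero _).2 h4

/-- Law of large numbers for tree functions with bounded increments. -/
lemma ae_tendsto_sub_sum_drift_div [IsProbabilityMeasure μ] (h : IsTwoTypeBPWith μ p BP Y H)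
    (hp0 : 0 < p) (hp1 : p < 1) {φ : ColouredTree → ℝ} {C : ℝ}
    (hC : ∀ T, Valid T → ∀ x ∈ children T, |φ (x :: T) - φ T| ≤ C) :
    ∀ᵐ ω ∂μ, Tendsto (fun n : ℕ => (φ (Y n ω) - ∑ i ∈ Finset.range n, drift p φ (Y i ω)) / n)
      atTop (𝓝 0) := by
  filter_upwards [h.ae_tendsto_compensated_div hp0 hp1 hC, h.start, h.ae_jump hp0 hp1]
    with ω hω h0 hj
  have h1 : ∀ n, compensated p φ (Y n ω) =
      φ (Y n ω) - φ [] - ∑ i ∈ Finset.range n, drift p φ (Y i ω) := by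
    intro n
    induction n with
    | zero => simp [h0, compensated]
    | succ n ih =>
      obtain ⟨-, x, hx, hY⟩ := hj n
      rw [Finset.sum_range_succ, hY, compensated, ih]
      ring
  have h2 := hω.add (tendsto_const_div_atTop_nhds_zero_nat (φ []))
  rw [add_zero] at h2
  refine h2.congr fun n => ?_
  rw [h1, ← add_div]
  congr 1
  ring

lemma ae_tendsto_mass_div [IsProbabilityMeasure μ] (h : IsTwoTypeBPWith μ p BP Y H)
    (hp0 : 0 < p) (hp1 : p < 1) :
    ∀ᵐ ω ∂μ, Tendsto (fun n : ℕ => mass (Y n ω) / n) atTop (𝓝 (2 - p)) := by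
  have hC : ∀ T, Valid T → ∀ x ∈ children T, |mass (x :: T) - mass T| ≤ 2 := by
    intro T _ x _
    rw [mass_cons, add_sub_cancel_left]
    split_ifs <;> norm_num
  filter_upwards [h.ae_tendsto_sub_sum_drift_div hp0 hp1 hC] with ω hω
  have h2 := hω.add_const (2 - p)
  rw [zero_add] at h2
  refine h2.congr' ?_
  filter_upwards [eventually_gt_atTop 0] with n hn
  have : (n : ℝ) ≠ 0 := by positivity
  simp only [drift, sum_weight_mul_mass_sub, Finset.sum_const, Finset.card_range, nsmul_eq_mul]
  field_simp
  ring

/-- Induction starts at k = 0, where Z_{≥0} = n + 1 and the product is empty. With K = (k+1)(1-p),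
each step multiplies the limit by K/(2-p+K) = (k+1)/(k+1+(2-p)/(1-p)). -/
lemma ae_tendsto_numAtLeast_div_mass [IsProbabilityMeasure μ] (h : IsTwoTypeBPWith μ p BP Y H)
    (hp0 : 0 < p) (hp1 : p < 1) (k : ℕ) :
    ∀ᵐ ω ∂μ, Tendsto (fun n : ℕ => (numAtLeast (Y n ω) k : ℝ) / mass (Y n ω)) atTop
      (𝓝 (pAtLeast p k / (2 - p))) := by
  have hl : (0 : ℝ) < 2 - p := by linarith
  induction k with
  | zero =>
    filter_upwards [h.ae_tendsto_mass_div hp0 hp1, h.ae_history hp0 hp1] with ω hω hv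
    have h1 : Tendsto (fun n : ℕ => 1 + 1 / (n : ℝ)) atTop (𝓝 1) := by
      simpa using (tendsto_const_div_atTop_nhds_zero_nat (1 : ℝ)).const_add 1
    have h2 := h1.div hω hl.ne'
    have h3 : pAtLeast p 0 = 1 := by simp [pAtLeast]
    rw [h3]
    refine h2.congr' ?_
    filter_upwards [eventually_gt_atTop 0] with n hn
    have : (n : ℝ) ≠ 0 := by positivity
    have := (mass_pos (Y n ω)).ne'
    rw [numAtLeast_zero, (hv n).2.1, Pi.div_apply]
    push_cast
    field_simp
  | succ k ih =>
    have hC : ∀ T, Valid T → ∀ x ∈ children T,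
        |(numAtLeast (x :: T) (k + 1) : ℝ) - numAtLeast T (k + 1)| ≤ 1 := by
      intro T hT x hx
      rw [hT.numAtLeast_cons hx, Nat.cast_add, add_sub_cancel_left]
      split_ifs <;> norm_num
    filter_upwards [h.ae_tendsto_sub_sum_drift_div hp0 hp1
      (φ := fun T => (numAtLeast T (k + 1) : ℝ)) hC, ih, h.ae_tendsto_mass_div hp0 hp1,
      h.ae_history hp0 hp1] with ω hω hz hm hv
    set K : ℝ := (k + 1) * (1 - p) with hK
    have hKpos : 0 < K := mul_pos (by positivity) (by linarith)
    set y : ℕ → ℝ := fun n => (numAtLeast (Y n ω) (k + 1) : ℝ) / mass (Y n ω) with hy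
    set z : ℕ → ℝ := fun n => (numAtLeast (Y n ω) k : ℝ) / mass (Y n ω) with hzdef
    have hdrift : ∀ i, drift p (fun T => (numAtLeast T (k + 1) : ℝ)) (Y i ω) = K * (z i - y i) := by
      intro i
      rw [drift, sum_weight_mul_numAtLeast_sub p (hv i).1, (hv i).1.totalRate_eq]
      simp only [hy, hzdef, hK]
      ring
    have hy1 : ∀ n, ‖y n‖ ≤ 1 := by
      intro n
      rw [Real.norm_eq_abs, abs_of_nonneg (div_nonneg (Nat.cast_nonneg _) (mass_pos _).le)]
      refine (div_le_one (mass_pos _)).2 (le_trans ?_ (size_le_mass _))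
      exact_mod_cast numAtLeast_le_size _ _
    have hm0 : Tendsto (fun n : ℕ => mass (Y n ω) / n - (2 - p)) atTop (𝓝 0) := by
      simpa using hm.sub_const (2 - p)
    have hb : Tendsto (fun n : ℕ => (mass (Y n ω) / n - (2 - p)) * y n) atTop (𝓝 0) :=
      hm0.zero_mul_isBoundedUnder_le (isBoundedUnder_of ⟨1, hy1⟩)
    -- Replacing mass/n by 2 - p costs o(1) because y is bounded; adding K times the average of z
    -- then leaves (2-p) y + K · average of y.
    have hlim := (((hω.sub hb).add (hz.cesaro.const_mul K)).div_const (2 - p))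
    have hlim' : Tendsto (fun n : ℕ => y n + K / (2 - p) * ((∑ i ∈ Finset.range n, y i) / n)) atTop
        (𝓝 (K * (pAtLeast p k / (2 - p)) / (2 - p))) := by
      simp only [sub_zero, zero_add] at hlim
      refine hlim.congr' ?_
      filter_upwards [eventually_gt_atTop 0] with n hn
      have hn0 : (n : ℝ) ≠ 0 := by positivity
      have hmy : (numAtLeast (Y n ω) (k + 1) : ℝ) = mass (Y n ω) * y n := by
        simp only [hy]
        field_simp [(mass_pos (Y n ω)).ne']
      simp only [hdrift, ← Finset.mul_sum, Finset.sum_sub_distrib, hmy]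
      field_simp
      ring
    have hfinal := tendsto_of_tendsto_add_cesaro (div_nonneg hKpos.le hl.le) hlim'
    convert hfinal using 2
    rw [pAtLeast, pAtLeast, Finset.prod_Icc_succ_top (by omega), Nat.factorial_succ]
    have h1p : (1 - p) ≠ 0 := by linarith
    have hd : (2 - p) + K ≠ 0 := by positivity
    have hd' : ((k : ℝ) + 1) * (1 - p) + (2 - p) ≠ 0 := by rw [← hK]; positivity
    rw [hK]
    generalize ∏ i ∈ Finset.Icc 1 k, ((i : ℝ) + (2 - p) / (1 - p))⁻¹ = P
    push_cast
    rw [hK] at hd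
    have e1 : ((k : ℝ) + 1 + (2 - p) / (1 - p)) = (((k : ℝ) + 1) * (1 - p) + (2 - p)) / (1 - p) := by
      field_simp
    have e2 : 1 + ((k : ℝ) + 1) * (1 - p) / (2 - p) =
        (((k : ℝ) + 1) * (1 - p) + (2 - p)) / (2 - p) := by
      field_simp
      ring
    rw [e1, e2]
    field_simp

end IsTwoTypeBPWith
-- The martingale at the jump times
/-- The trees and the holding times up to the `n`-th jump. -/
def history {Ω : Type*} (Y : ℕ → Ω → ColouredTree) (H : ℕ → Ω → ℝ) (n : ℕ) (ω : Ω) :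
    (Fin (n + 1) → ColouredTree) × (Fin n → ℝ) :=
  (fun i => Y i ω, fun i => H i ω)

/-- The process `e^{-(2-p)t} (|BP(t)| + B(t))` at the time of the `n`-th jump. -/
noncomputable def jumpMartingale {Ω : Type*} (p : ℝ) (Y : ℕ → Ω → ColouredTree)
    (H : ℕ → Ω → ℝ) (n : ℕ) (ω : Ω) : ℝ :=
  Real.exp (-(2 - p) * ∑ i ∈ Finset.range n, H i ω) * mass (Y n ω)

lemma jumpMartingale_nonneg {Ω : Type*} {p : ℝ} {Y : ℕ → Ω → ColouredTree} {H : ℕ → Ω → ℝ}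
    (n : ℕ) (ω : Ω) : 0 ≤ jumpMartingale p Y H n ω :=
  mul_nonneg (Real.exp_pos _).le (mass_pos _).le

namespace IsTwoTypeBPWith

lemma measurable_history (h : IsTwoTypeBPWith μ p BP Y H) (n : ℕ) : Measurable (history Y H n) :=
  (measurable_pi_lambda (fun ω => fun i : Fin (n + 1) => Y i ω) fun i => h.measurable_Y i).prodMk
    (h.measurable_past n)

/-- The filtration generated by the trees and the holding times. -/
def filtration (h : IsTwoTypeBPWith μ p BP Y H) : Filtration ℕ ‹MeasurableSpace Ω› where
  seq n := MeasurableSpace.comap (history Y H n) inferInstance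
  mono' m n hmn := by
    have hfac : history Y H m = (fun z : (Fin (n + 1) → ColouredTree) × (Fin n → ℝ) =>
        ((fun i : Fin (m + 1) => z.1 (Fin.castLE (by omega) i)),
          (fun i : Fin m => z.2 (Fin.castLE hmn i)))) ∘ history Y H n := rfl
    change MeasurableSpace.comap (history Y H m) inferInstance ≤ _
    rw [hfac, ← MeasurableSpace.comap_comp]
    refine MeasurableSpace.comap_mono (Measurable.comap_le ?_)
    fun_prop
  le' n := (h.measurable_history n).comap_le

lemma stronglyAdapted_jumpMartingale (h : IsTwoTypeBPWith μ p BP Y H) :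
    StronglyAdapted h.filtration (jumpMartingale p Y H) := by
  intro n
  have hg : Measurable fun z : (Fin (n + 1) → ColouredTree) × (Fin n → ℝ) =>
      Real.exp (-(2 - p) * ∑ i, z.2 i) * mass (z.1 (Fin.last n)) := by
    have : Measurable mass := Measurable.of_discrete
    fun_prop
  have hfac : jumpMartingale p Y H n = (fun z : (Fin (n + 1) → ColouredTree) × (Fin n → ℝ) =>
      Real.exp (-(2 - p) * ∑ i, z.2 i) * mass (z.1 (Fin.last n))) ∘ history Y H n := by
    ext ω
    simp [jumpMartingale, history, Finset.sum_range]
  rw [hfac]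
  exact (hg.comp (comap_measurable _)).stronglyMeasurable

lemma measurable_jumpMartingale (h : IsTwoTypeBPWith μ p BP Y H) (n : ℕ) :
    Measurable (jumpMartingale p Y H n) :=
  ((h.stronglyAdapted_jumpMartingale n).mono (h.filtration.le n)).measurable

/-- The factor q/(q+2-p) from the holding time cancels the growth of the expected mass from q to
q+2-p; this needs total rate equal to mass. -/
lemma setLIntegral_jumpMartingale_succ [IsProbabilityMeasure μ] (h : IsTwoTypeBPWith μ p BP Y H)
    (hp0 : 0 < p) (hp1 : p < 1) (n : ℕ) {B : Set Ω} (hB : MeasurableSet[h.filtration n] B) :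
    ∫⁻ ω in B, ENNReal.ofReal (jumpMartingale p Y H (n + 1) ω) ∂μ =
      ∫⁻ ω in B, ENNReal.ofReal (jumpMartingale p Y H n ω) ∂μ := by
  have hBm : MeasurableSet B := h.filtration.le n B hB
  obtain ⟨D, hD, rfl⟩ := hB
  rw [← lintegral_indicator hBm, ← lintegral_indicator hBm, h.lintegral_eq_tsum n,
    h.lintegral_eq_tsum n]
  refine tsum_congr fun T => ?_
  -- On {Y n = T} the earlier trees are tails of T, so a past event constrains only the holding
  -- times.
  set A : Set (Fin n → ℝ) := {z | ((fun i : Fin (n + 1) => (T.drop (n - i) : ColouredTree)), z) ∈ D}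
    with hA
  have hAm : MeasurableSet A := hD.preimage (measurable_const.prodMk measurable_id)
  set f : (Fin n → ℝ) → ℝ≥0∞ :=
    A.indicator fun z => ENNReal.ofReal (Real.exp (-(2 - p) * ∑ i, z i)) with hf
  have hfm : Measurable f := Measurable.indicator (by fun_prop) hAm
  have hψ : Measurable fun s : ℝ => ENNReal.ofReal (Real.exp (-(2 - p) * s)) := by fun_prop
  have hmem : ∀ᵐ ω ∂μ, Y n ω = T →
      (ω ∈ history Y H n ⁻¹' D ↔ (fun i : Fin n => H i ω) ∈ A) := by
    filter_upwards [h.ae_history hp0 hp1] with ω hω hT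
    have : history Y H n ω = ((fun i : Fin (n + 1) => (T.drop (n - i) : ColouredTree)),
        fun i : Fin n => H i ω) := by
      refine Prod.ext (funext fun i => ?_) rfl
      rw [← hT]
      exact (hω n).2.2 i (by omega)
    simp only [Set.mem_preimage, this]
    rfl
  have hL : ∫⁻ ω in {ω | Y n ω = T}, (history Y H n ⁻¹' D).indicator
      (fun ω => ENNReal.ofReal (jumpMartingale p Y H (n + 1) ω)) ω ∂μ =
      ∫⁻ ω in {ω | Y n ω = T}, f (fun i => H i ω) * ENNReal.ofReal (Real.exp (-(2 - p) * H n ω)) *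
        ENNReal.ofReal (mass (Y (n + 1) ω)) ∂μ := by
    refine setLIntegral_congr_fun_ae (h.measurable_state n T) ?_
    filter_upwards [hmem] with ω hω hT
    by_cases hd : ω ∈ history Y H n ⁻¹' D
    · rw [Set.indicator_of_mem hd, hf, Set.indicator_of_mem ((hω hT).1 hd),
        ← ENNReal.ofReal_mul (Real.exp_pos _).le, ← ENNReal.ofReal_mul (by positivity),
        ← Real.exp_add, jumpMartingale, Finset.sum_range_succ, mul_add, Finset.sum_range]
    · rw [Set.indicator_of_notMem hd, hf, Set.indicator_of_notMem fun h' => hd ((hω hT).2 h')]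
      simp
  have hR : ∫⁻ ω in {ω | Y n ω = T}, (history Y H n ⁻¹' D).indicator
      (fun ω => ENNReal.ofReal (jumpMartingale p Y H n ω)) ω ∂μ =
      ∫⁻ ω in {ω | Y n ω = T}, f (fun i => H i ω) * ENNReal.ofReal (mass T) ∂μ := by
    refine setLIntegral_congr_fun_ae (h.measurable_state n T) ?_
    filter_upwards [hmem] with ω hω hT
    have hT' : Y n ω = T := hT
    by_cases hd : ω ∈ history Y H n ⁻¹' D
    · rw [Set.indicator_of_mem hd, hf, Set.indicator_of_mem ((hω hT).1 hd),
        ← ENNReal.ofReal_mul (Real.exp_pos _).le, jumpMartingale, Finset.sum_range, hT']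
    · rw [Set.indicator_of_notMem hd, hf, Set.indicator_of_notMem fun h' => hd ((hω hT).2 h')]
      simp
  rw [hL, hR, h.setLIntegral_step hp0 hp1 n T hfm hψ fun S => ENNReal.ofReal (mass S),
    lintegral_mul_const _ (show Measurable fun ω => f (fun i => H i ω) from
      hfm.comp (h.measurable_past n))]
  by_cases hT : Valid T
  · have hq := totalRate_pos T
    have hl : (0 : ℝ) < 2 - p := by linarith
    have hsum : ∑ x ∈ children T, weight p T x * mass (x :: T) = totalRate T + (2 - p) := by
      rw [← sum_weight_mul_mass_sub p T, hT.totalRate_eq]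
      simp only [mul_sub, Finset.sum_sub_distrib, ← Finset.sum_mul, sum_weight]
      ring
    rw [lintegral_exp_neg_mul_expMeasure hq hl,
      Finset.sum_congr rfl fun x _ => (ENNReal.ofReal_mul (weight_nonneg hp0 hp1 T x)).symm,
      ← ENNReal.ofReal_sum_of_nonneg fun x _ =>
        mul_nonneg (weight_nonneg hp0 hp1 T x) (mass_pos _).le, hsum,
      ← ENNReal.ofReal_mul (by positivity), div_mul_cancel₀ _ (by positivity), hT.totalRate_eq]
  · have h0 : μ {ω | Y n ω = T} = 0 := by
      have hne : ∀ᵐ ω ∂μ, ¬ Y n ω = T := by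
        filter_upwards [h.ae_history hp0 hp1] with ω hω hT'
        exact hT (hT' ▸ (hω n).1)
      simpa [ae_iff] using hne
    simp [Measure.restrict_eq_zero.2 h0]

lemma lintegral_jumpMartingale [IsProbabilityMeasure μ] (h : IsTwoTypeBPWith μ p BP Y H)
    (hp0 : 0 < p) (hp1 : p < 1) (n : ℕ) :
    ∫⁻ ω, ENNReal.ofReal (jumpMartingale p Y H n ω) ∂μ = 1 := by
  induction n with
  | zero =>
    rw [lintegral_congr_ae (g := fun _ => 1)]
    · simp
    · filter_upwards [h.start] with ω hω
      simp [jumpMartingale, hω, mass_nil]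
  | succ n ih =>
    have := h.setLIntegral_jumpMartingale_succ hp0 hp1 n MeasurableSet.univ
    rw [← ih]
    simpa using this

lemma integrable_jumpMartingale [IsProbabilityMeasure μ] (h : IsTwoTypeBPWith μ p BP Y H)
    (hp0 : 0 < p) (hp1 : p < 1) (n : ℕ) : Integrable (jumpMartingale p Y H n) μ := by
  refine ⟨(h.measurable_jumpMartingale n).aestronglyMeasurable, ?_⟩
  rw [hasFiniteIntegral_iff_ofReal (ae_of_all _ fun ω => jumpMartingale_nonneg n ω),
    h.lintegral_jumpMartingale hp0 hp1]
  exact ENNReal.one_lt_top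

lemma martingale_jumpMartingale [IsProbabilityMeasure μ] (h : IsTwoTypeBPWith μ p BP Y H)
    (hp0 : 0 < p) (hp1 : p < 1) : Martingale (jumpMartingale p Y H) h.filtration μ := by
  refine martingale_of_setIntegral_eq_succ h.stronglyAdapted_jumpMartingale
    (h.integrable_jumpMartingale hp0 hp1) fun n B hB => ?_
  rw [integral_eq_lintegral_of_nonneg_ae (ae_of_all _ fun ω => jumpMartingale_nonneg n ω)
      (h.measurable_jumpMartingale n).aestronglyMeasurable,
    integral_eq_lintegral_of_nonneg_ae (ae_of_all _ fun ω => jumpMartingale_nonneg (n + 1) ω)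
      (h.measurable_jumpMartingale (n + 1)).aestronglyMeasurable,
    h.setLIntegral_jumpMartingale_succ hp0 hp1 n hB]

/-- A martingale bounded in L¹, here with norm 1, converges almost surely. -/
lemma exists_ae_tendsto_jumpMartingale [IsProbabilityMeasure μ] (h : IsTwoTypeBPWith μ p BP Y H)
    (hp0 : 0 < p) (hp1 : p < 1) : ∃ W : Ω → ℝ, Measurable W ∧
      ∀ᵐ ω ∂μ, Tendsto (fun n => jumpMartingale p Y H n ω) atTop (𝓝 (W ω)) := by
  have hb : ∀ n, eLpNorm (jumpMartingale p Y H n) 1 μ ≤ ((1 : ℝ≥0) : ℝ≥0∞) := by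
    intro n
    rw [eLpNorm_one_eq_lintegral_enorm,
      lintegral_congr fun ω => Real.enorm_of_nonneg (jumpMartingale_nonneg n ω),
      h.lintegral_jumpMartingale hp0 hp1]
    simp
  exact measurable_limit_of_tendsto_metrizable_ae
    (fun n => (h.measurable_jumpMartingale n).aemeasurable)
    ((h.martingale_jumpMartingale hp0 hp1).submartingale.exists_ae_tendsto_of_bdd hb)

end IsTwoTypeBPWith

/-! ### From jump times to continuous time -/

/-- If `e^{-λ τ n} S n` converges along jump times `τ n`, then it converges along continuous time,
where `X t` is the state at time `t`. -/
lemma tendsto_exp_mul_of_tendsto_jump {α : Type*} {S : α → ℝ} {X : ℝ≥0 → α} {y : ℕ → α}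
    {τ : ℕ → ℝ} {l w : ℝ} (hl : 0 < l) (hS : ∀ a, 0 < S a) (hτ0 : τ 0 = 0) (hτ : StrictMono τ)
    (hX : ∀ (n : ℕ) (t : ℝ≥0), τ n ≤ t → (t : ℝ) < τ (n + 1) → X t = y n)
    (hy : Tendsto (fun n => S (y n)) atTop atTop)
    (hratio : Tendsto (fun n => S (y n) / S (y (n + 1))) atTop (𝓝 1))
    (hM : Tendsto (fun n => Real.exp (-l * τ n) * S (y n)) atTop (𝓝 w)) :
    Tendsto (fun t : ℝ≥0 => Real.exp (-l * t) * S (X t)) atTop (𝓝 w) ∧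
      ∃ N : ℝ≥0 → ℕ, Tendsto N atTop atTop ∧ ∀ t, X t = y (N t) := by
  -- Non-explosion: e^{-lτ_n} is a convergent sequence divided by S(y_n) → ∞, hence tends to 0.
  have hτtop : Tendsto τ atTop atTop := by
    have h1 : Tendsto (fun n => Real.exp (-l * τ n)) atTop (𝓝 0) := by
      have h2 := hM.mul hy.inv_tendsto_atTop
      rw [mul_zero] at h2
      refine h2.congr fun n => ?_
      rw [Pi.inv_apply, mul_inv_cancel_right₀ (hS _).ne']
    have h2 := Real.tendsto_exp_comp_nhds_zero.1 h1
    have h3 := h2.const_mul_atBot_of_neg (r := -l⁻¹) (by simpa using hl)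
    refine h3.congr fun n => ?_
    field_simp
  have hex : ∀ t : ℝ≥0, ∃ n, τ n ≤ t ∧ (t : ℝ) < τ (n + 1) := by
    intro t
    have hex' : ∃ n, (t : ℝ) < τ n := (hτtop.eventually_gt_atTop (t : ℝ)).exists
    classical
    obtain ⟨m, hm⟩ : ∃ m, Nat.find hex' = m + 1 := by
      refine Nat.exists_eq_succ_of_ne_zero fun h0 => ?_
      have := Nat.find_spec hex'
      rw [h0, hτ0] at this
      exact absurd this (not_lt.2 t.coe_nonneg)
    refine ⟨m, not_lt.1 (Nat.find_min hex' (by omega)), ?_⟩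
    rw [← hm]
    exact Nat.find_spec hex'
  choose N hN1 hN2 using hex
  have hNtop : Tendsto N atTop atTop := by
    refine tendsto_atTop.2 fun m => ?_
    obtain ⟨t0, ht0⟩ : ∃ t0 : ℝ≥0, τ m ≤ t0 := ⟨(τ m).toNNReal, Real.le_coe_toNNReal _⟩
    filter_upwards [eventually_ge_atTop t0] with t ht
    have h1 : τ m < τ (N t + 1) := (ht0.trans (by exact_mod_cast ht)).trans_lt (hN2 t)
    have := hτ.lt_iff_lt.1 h1
    omega
  refine ⟨?_, N, hNtop, fun t => hX _ t (hN1 t) (hN2 t)⟩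
  -- Between jumps S is constant, so the value lies between e^{-lτ_{n+1}} S(y_n) and e^{-lτ_n}
  -- S(y_n); the ratio hypothesis gives both bounds the limit w.
  have hlow : Tendsto (fun n => Real.exp (-l * τ (n + 1)) * S (y (n + 1)) *
      (S (y n) / S (y (n + 1)))) atTop (𝓝 w) := by
    simpa using ((tendsto_add_atTop_iff_nat 1).2 hM).mul hratio
  refine tendsto_of_tendsto_of_tendsto_of_le_of_le (hlow.comp hNtop) (hM.comp hNtop) ?_ ?_
  · intro t
    simp only [Function.comp]
    rw [hX _ t (hN1 t) (hN2 t), mul_assoc, mul_div_cancel₀ _ (hS _).ne']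
    refine mul_le_mul_of_nonneg_right (Real.exp_le_exp.2 ?_) (hS _).le
    nlinarith [hN2 t]
  · intro t
    simp only [Function.comp]
    rw [hX _ t (hN1 t) (hN2 t)]
    refine mul_le_mul_of_nonneg_right (Real.exp_le_exp.2 ?_) (hS _).le
    nlinarith [hN1 t]

namespace IsTwoTypeBPWith

lemma ae_tendsto_of_tendsto_jumpMartingale [IsProbabilityMeasure μ]
    (h : IsTwoTypeBPWith μ p BP Y H) (hp0 : 0 < p) (hp1 : p < 1) {W : Ω → ℝ}
    (hW : ∀ᵐ ω ∂μ, Tendsto (fun n => jumpMartingale p Y H n ω) atTop (𝓝 (W ω))) :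
    ∀ᵐ ω ∂μ, Tendsto (fun t : ℝ≥0 => martingaleM p BP t ω) atTop (𝓝 (W ω)) ∧
      ∃ N : ℝ≥0 → ℕ, Tendsto N atTop atTop ∧ ∀ t, BP t ω = Y (N t) ω := by
  have hl : (0 : ℝ) < 2 - p := by linarith
  filter_upwards [hW, h.path, h.ae_jump hp0 hp1, h.ae_history hp0 hp1,
    h.ae_tendsto_mass_div hp0 hp1] with ω hω hpath hj hv hm
  have hmono : StrictMono fun n => ∑ i ∈ Finset.range n, H i ω :=
    strictMono_nat_of_lt_succ fun n => by
      rw [Finset.sum_range_succ]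
      linarith [(hj n).1]
  have htop : Tendsto (fun n => mass (Y n ω)) atTop atTop := by
    refine tendsto_atTop_mono (fun n => ?_) tendsto_natCast_atTop_atTop
    refine le_trans ?_ (size_le_mass _)
    rw [(hv n).2.1]
    push_cast
    linarith
  -- Each birth adds at most 2 to a mass that tends to infinity.
  have hratio : Tendsto (fun n => mass (Y n ω) / mass (Y (n + 1) ω)) atTop (𝓝 1) := by
    have h0 := ((tendsto_add_atTop_iff_nat 1).2 htop).inv_tendsto_atTop.const_mul 2
    have h1 : Tendsto (fun n => 1 - 2 * (mass (Y (n + 1) ω))⁻¹) atTop (𝓝 1) := by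
      simpa using h0.const_sub 1
    have hstep : ∀ n, mass (Y n ω) ≤ mass (Y (n + 1) ω) ∧
        mass (Y (n + 1) ω) ≤ mass (Y n ω) + 2 := by
      intro n
      obtain ⟨-, x, hx, hY⟩ := hj n
      rw [hY, mass_cons]
      split_ifs <;> constructor <;> linarith
    refine tendsto_of_tendsto_of_tendsto_of_le_of_le h1 tendsto_const_nhds (fun n => ?_)
      fun n => (div_le_one (mass_pos _)).2 (hstep n).1
    rw [le_div_iff₀ (mass_pos _), sub_mul, mul_assoc, inv_mul_cancel₀ (mass_pos _).ne']
    linarith [(hstep n).2]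
  exact tendsto_exp_mul_of_tendsto_jump (S := mass) (X := fun t => BP t ω) (y := fun n => Y n ω) hl
    mass_pos (by simp) hmono hpath htop hratio hω

end IsTwoTypeBPWith

end TwoTypeBranching

theorem mainTheorem5 {Ω : Type*} [MeasurableSpace Ω] (μ : Measure Ω) [IsProbabilityMeasure μ]
    (p : ℝ) (hp0 : 0 < p) (hp1 : p < 1)
    (BP : ℝ≥0 → Ω → TwoTypeBranching.ColouredTree)
    (hBP : TwoTypeBranching.IsTwoTypeBP μ p BP) :
    ∃ W : Ω → ℝ, Measurable W ∧
      (∀ᵐ ω ∂μ, Tendsto (fun t : ℝ≥0 => TwoTypeBranching.martingaleM p BP t ω)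
        atTop (𝓝 (W ω))) ∧
      ∀ k : ℕ, 1 ≤ k → ∀ᵐ ω ∂μ,
        Tendsto (fun t : ℝ≥0 => Real.exp (-(2 - p) * (t : ℝ)) *
            (TwoTypeBranching.ColouredTree.numAtLeast (BP t ω) k : ℝ))
          atTop (𝓝 (TwoTypeBranching.pAtLeast p k * (W ω / (2 - p)))) := by
  obtain ⟨Y, H, h⟩ := hBP
  obtain ⟨W, hWm, hW⟩ := h.exists_ae_tendsto_jumpMartingale hp0 hp1
  have hlim := h.ae_tendsto_of_tendsto_jumpMartingale hp0 hp1 hW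
  refine ⟨W, hWm, hlim.mono fun ω hω => hω.1, fun k _ => ?_⟩
  filter_upwards [hlim, h.ae_tendsto_numAtLeast_div_mass hp0 hp1 k] with ω ⟨hM, N, hN, hBP⟩ hk
  have h1 := (hk.comp hN).mul hM
  rw [div_mul_eq_mul_div, mul_div_assoc] at h1
  refine h1.congr fun t => ?_
  have hpos := (TwoTypeBranching.ColouredTree.mass_pos (BP t ω)).ne'
  simp only [Function.comp, ← hBP]
  rw [TwoTypeBranching.martingaleM, ← TwoTypeBranching.ColouredTree.mass]
  field_simp
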